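/- A conjunctive query (CQ) over a finite relational schema $\sigma$ (all arities positive) is a formula $q(\bar x)=\exists\bar y\bigwedge_{i=1}^m R_i(\bar x_i)$ whose free variables are exactly those in $\bar x$; it is Boolean if $\bar x$ is empty. For a database $D$ (a finite set of facts), $q(D)$ is the set of tuples $\bar a$ such that some homomorphism from the set of atoms of $q$ to $D$ maps $\bar x$ to $\bar a$. Write $q\subseteq q'$ if $q(D)\subseteq q'(D)$ for every database $D$. A tree decomposition of $q$ is a pair $(T,\chi)$ where $T$ is a finite tree and $\chi$ assigns to each node of $T$ a set of existentially quantified variables of $q$, such that for every atom $R_i(\bar x_i)$ some $\chi(t)$ contains all existentially quantified variables of $\bar x_i$, and for every existentially quantified variable $y$ the set of nodes $t$ with $y\in\chi(t)$ is connected in $T$. The width of a node $t$ is the least number of atoms of $q$ whose variables cover $\chi(t)$, the width of $(T,\chi)$ is the maximum width of its nodes, and the generalized hypertreewidth of $q$ is the minimum width of its tree decompositions. $\mathsf{GHW}(k)$ is the class of CQs of generalized hypertreewidth at most $k$. For CQs $q,q_1,q_2$ of the same arity put $q_1\sqsubseteq_q q_2$ if $q(D)\,\Delta\,q_2(D)\subseteq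 q(D)\,\Delta\,q_1(D)$ for every database $D$ (symmetric differences), and $q_1\sqsubset_q q_2$ if $q_1\sqsubseteq_q q_2$ but not $q_2\sqsubseteq_q q_1$. A CQ $q'\in\mathsf{GHW}(\ell)$ is a $\mathsf{GHW}(\ell)$-overapproximation of $q$ if $q\subseteq q'$ and there is no $q''\in\mathsf{GHW}(\ell)$ with $q\subseteq q''$ and $q'\sqsubset_q q''$. For a tournament $G$ on nodes $v_1,\dots,v_m$ with edge relation $E$, a set $B$ of nodes and a node $v\notin B$, let $\mathrm{conn}(v,B)=(e_1,\dots,e_m)$, where $e_p=\#$ if $v_p\notin B$, $e_p=1$ if $v_p\in B$ and $E(v,v_p)$, and $e_p=-1$ otherwise. Condition $(\dagger)$ says: for every $B$ with $2\le|B|\le m-2$ and every node $v\notin B$ there is a node $v'\notin B$ with $\mathrm{conn}(v,B)\ne\mathrm{conn}(v',B)$. **Theorem.** For each $k>1$ there is a tournament $G$ on $2k-1$ nodes $v_1,\dots,v_{2k-1}$ that contains the directed cycle $v_1\to v_2\to v_3\to v_1$ and satisfies $(\dagger)$, such that the Boolean CQ $q$ over a single binary relation symbol $E$ whose variables are the nodes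 of $G$ and whose atoms are the edges of $G$ belongs to $\mathsf{GHW}(k)$ and has no $\mathsf{GHW}(\ell)$-overapproximation for any $1\le\ell<k$. In particular, for each $k>1$ there is a Boolean CQ in $\mathsf{GHW}(k)$ without $\mathsf{GHW}(\ell)$-overapproximations for any $1\le\ell<k$. -/

import Mathlib

/-! # Conjunctive queries, generalized hypertreewidth and overapproximations -/

/-- A relational schema: finitely many relation symbols, each of positive arity. -/
structure Schema where
  Rel : Type
  rel_finite : Finite Rel
  arity : Rel → ℕ
  arity_pos : ∀ R, 0 < arity R

/-- An atom `R(x₁,…,xₙ)` over the schema `σ` with entries in `α`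
(variables for queries, constants for databases). -/
structure Atom (σ : Schema) (α : Type) where
  rel : σ.Rel
  args : Fin (σ.arity rel) → α

/-- The image `R(h(x₁),…,h(xₙ))` of an atom. -/
def Atom.map {σ : Schema} {α β : Type} (h : α → β) (a : Atom σ α) : Atom σ β :=
  ⟨a.rel, h ∘ a.args⟩

/-- The set of entries occurring in an atom. -/
def Atom.vars {σ : Schema} {α : Type} (a : Atom σ α) : Set α := Set.range a.args

/-- A database: a finite (possibly empty) set of facts over a nonempty ambient set `Dom` of
constants. Constants of `Dom` that occur in no fact play no role. -/
structure Database (σ : Schema) where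
  Dom : Type
  dom_nonempty : Nonempty Dom
  facts : Set (Atom σ Dom)
  facts_finite : facts.Finite

/-- A conjunctive query with `n`-ary tuple `free` of free variables (repetitions allowed), all of
which occur in some atom. All other variables are existentially quantified. For `n = 0` the query
is Boolean. -/
structure CQ (σ : Schema) (n : ℕ) where
  V : Type
  atoms : Set (Atom σ V)
  atoms_finite : atoms.Finite
  free : Fin n → V
  free_mem : ∀ i, ∃ a ∈ atoms, free i ∈ a.vars

namespace CQ

variable {σ : Schema} {n : ℕ}

/-- The result `q(D)`: all tuples `ā` such that some homomorphism from the canonical database of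
`q` (whose facts are the atoms of `q`) to `D` maps the free variables to `ā`. -/
def eval (q : CQ σ n) (D : Database σ) : Set (Fin n → D.Dom) :=
  {t | ∃ h : q.V → D.Dom, (∀ a ∈ q.atoms, a.map h ∈ D.facts) ∧ h ∘ q.free = t}

/-- Containment of queries: `q(D) ⊆ q'(D)` over every database `D`. -/
def Contained (q q' : CQ σ n) : Prop := ∀ D : Database σ, q.eval D ⊆ q'.eval D

/-- The existentially quantified variables. -/
def exVars (q : CQ σ n) : Set q.V := {y | y ∉ Set.range q.free}

/-- Tree decompositions `(T, χ)` of a conjunctive query: the bags consist of existentially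
quantified variables. -/
structure TreeDecomposition (q : CQ σ n) where
  Node : Type
  node_finite : Finite Node
  tree : SimpleGraph Node
  isTree : tree.IsTree
  bag : Node → Set q.V
  bag_subset : ∀ t, bag t ⊆ q.exVars
  atom_subset : ∀ a ∈ q.atoms, ∃ t, a.vars ∩ q.exVars ⊆ bag t
  preconnected : ∀ y ∈ q.exVars, (tree.induce {t | y ∈ bag t}).Preconnected

/-- The width of a node: the least number of atoms of `q` whose variables cover the bag. -/
noncomputable def TreeDecomposition.nodeWidth {q : CQ σ n} (T : q.TreeDecomposition)
    (t : T.Node) : ℕ∞ :=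
  ⨅ (I : Finset (Atom σ q.V)) (_ : (I : Set (Atom σ q.V)) ⊆ q.atoms)
    (_ : T.bag t ⊆ ⋃ a ∈ I, a.vars), (I.card : ℕ∞)

/-- The width of a tree decomposition: the maximum width of its nodes. -/
noncomputable def TreeDecomposition.width {q : CQ σ n} (T : q.TreeDecomposition) : ℕ∞ :=
  ⨆ t, T.nodeWidth t

/-- The generalized hypertreewidth: the minimum width of a tree decomposition. -/
noncomputable def ghw (q : CQ σ n) : ℕ∞ := ⨅ T : q.TreeDecomposition, T.width

/-- The class `GHW(k)` of queries of generalized hypertreewidth at most `k`. -/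
def GHW (k : ℕ) : Set (CQ σ n) := {q | q.ghw ≤ k}

/-- The order `q₁ ⊑_q q₂`: over every database, the symmetric difference of `q₂` and `q` is
contained in the symmetric difference of `q₁` and `q`. -/
def ApproxLE (q q₁ q₂ : CQ σ n) : Prop :=
  ∀ D : Database σ, symmDiff (q.eval D) (q₂.eval D) ⊆ symmDiff (q.eval D) (q₁.eval D)

/-- The strict part `q₁ ⊏_q q₂` of `⊑_q`. -/
def ApproxLT (q q₁ q₂ : CQ σ n) : Prop := ApproxLE q q₁ q₂ ∧ ¬ ApproxLE q q₂ q₁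

/-- `q'` is a `GHW(k)`-overapproximation of `q`: it is `⊑_q`-maximal among the queries in
`GHW(k)` that contain `q`. -/
def IsOverapproximation (k : ℕ) (q q' : CQ σ n) : Prop :=
  q' ∈ GHW k ∧ q.Contained q' ∧
    ¬ ∃ q'' : CQ σ n, q'' ∈ GHW k ∧ q.Contained q'' ∧ ApproxLT q q' q''

end CQ

/-- The schema of directed graphs: a single binary relation symbol `E`. -/
def graphSchema : Schema where
  Rel := Unit
  rel_finite := inferInstance
  arity := fun _ => 2
  arity_pos := fun _ => Nat.succ_pos 1

/-- The atom `E(u, v)`. -/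
def edgeAtom {V : Type} (u v : V) : Atom graphSchema V := ⟨(), ![u, v]⟩

/-- The Boolean query whose variables are the nodes of `G` and whose atoms are `E(u, v)` for the
edges `(u, v)` of `G`, that is, the Boolean query whose canonical database is `G`. -/
def digraphCQ {V : Type} [Finite V] (G : Digraph V) : CQ graphSchema 0 where
  V := V
  atoms := {a | ∃ u v, G.Adj u v ∧ a = edgeAtom u v}
  atoms_finite := (Set.finite_range fun p : V × V => edgeAtom p.1 p.2).subset (by
    rintro _ ⟨u, v, -, rfl⟩
    exact ⟨(u, v), rfl⟩)
  free := Fin.elim0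
  free_mem := fun i => i.elim0

/-- Tournaments: no loops, and exactly one of the two edges between any two distinct nodes. -/
def IsTournament {V : Type} (G : Digraph V) : Prop :=
  (∀ u, ¬ G.Adj u u) ∧ ∀ u v, u ≠ v → Xor (G.Adj u v) (G.Adj v u)

/-- The first three nodes `v₁, v₂, v₃` form a directed cycle `v₁ → v₂ → v₃ → v₁`
(the node `v_{i+1}` is the element `i` of `Fin m`). -/
def FirstThreeCycle {m : ℕ} (G : Digraph (Fin m)) : Prop :=
  ∃ h : 3 ≤ m, G.Adj ⟨0, by omega⟩ ⟨1, by omega⟩ ∧ G.Adj ⟨1, by omega⟩ ⟨2, by omega⟩ ∧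
    G.Adj ⟨2, by omega⟩ ⟨0, by omega⟩

open Classical in
/-- The tuple `conn(v, B)`, which records how `v` is connected with the nodes in `B`. The symbol
`#` is `none`. -/
noncomputable def conn {m : ℕ} (G : Digraph (Fin m)) (v : Fin m) (B : Finset (Fin m)) :
    Fin m → Option ℤ :=
  fun p => if p ∉ B then none else if G.Adj v p then some 1 else some (-1)

/-- Condition (†) for a graph on `m` nodes: for each set `B` of nodes with `2 ≤ |B| ≤ m - 2` and
each node `v` outside `B` there is a node `v'` outside `B` with `conn(v, B) ≠ conn(v', B)`. -/
def Dagger {m : ℕ} (G : Digraph (Fin m)) : Prop :=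
  ∀ B : Finset (Fin m), 2 ≤ B.card → B.card + 2 ≤ m →
    ∀ v ∉ B, ∃ v' ∉ B, conn G v B ≠ conn G v' B

/-! For Boolean queries, `GHW ℓ` is closed under conjunction. Conjoining an overapproximation q' of
q with any p in the class that contains q can only remove errors, so maximality forces q' to be
contained in p (`CQ.IsOverapproximation.contained`). It therefore suffices to find queries in `GHW
ℓ` that contain q and have no common lower bound in the class between them and q.

These are the band queries of width 2ℓ: windows of 2ℓ consecutive numbers form a path decomposition,
each window is covered by ℓ edges, and reduction modulo 2k-1 maps every band to the tournament
because 2ℓ < 2k-1 (`cyclicTournament_adj_mod`).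

An overapproximation q' would receive homomorphisms from arbitrarily long bands and itself map to
the tournament, so it would have no loops or directed 2-cycles. By `band_hom_ne` those homomorphisms
are injective: a shortest collision closes the band into a cycle, and the Helly property of subtrees
then yields a bag with 2ℓ+1 distinct variables, too many for ℓ binary atoms. Hence q' would have
more variables than it has (`exists_not_contained_bandCQ`). -/

/-! ## Trees -/

namespace SimpleGraph

variable {V W : Type}

/-- A tree can be rooted: there are a parent function and a depth function. -/
theorem IsTree.exists_parent {T : SimpleGraph V} (hT : T.IsTree) :
    ∃ (p : V → V) (d : V → ℕ), ∀ u v, T.Adj u v →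
      (p u = v ∧ d u = d v + 1) ∨ (p v = u ∧ d v = d u + 1) := by
  classical
  obtain ⟨r⟩ := hT.connected.nonempty
  -- Two neighbours of `u` closer to the root would give two shortest paths from `r` to `u`; paths
  -- in a tree are unique, so their penultimate nodes agree.
  have huniq : ∀ u v w, T.Adj u v → T.Adj u w → T.dist r u = T.dist r v + 1 →
      T.dist r u = T.dist r w + 1 → v = w := by
    intro u v w hv hw dv dw
    obtain ⟨a, -, ha⟩ := (hT.connected r v).exists_path_of_dist
    obtain ⟨b, -, hb⟩ := (hT.connected r w).exists_path_of_dist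
    have ha' : (a.concat hv.symm).IsPath :=
      Walk.isPath_of_length_eq_dist _ (by rw [Walk.length_concat, ha, dv])
    have hb' : (b.concat hw.symm).IsPath :=
      Walk.isPath_of_length_eq_dist _ (by rw [Walk.length_concat, hb, dw])
    have h := (hT.existsUnique_path r u).unique ha' hb'
    have h' := congrArg Walk.penultimate h
    simpa using h'
  refine ⟨fun u => if h : ∃ v, T.Adj u v ∧ T.dist r u = T.dist r v + 1 then h.choose else u,
    T.dist r, fun u v huv => ?_⟩
  have key : ∀ u v, T.Adj u v → T.dist r u = T.dist r v + 1 →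
      (if h : ∃ v, T.Adj u v ∧ T.dist r u = T.dist r v + 1 then h.choose else u) = v := by
    intro u v huv h
    have hex : ∃ v, T.Adj u v ∧ T.dist r u = T.dist r v + 1 := ⟨v, huv, h⟩
    rw [dif_pos hex]
    exact huniq u _ _ hex.choose_spec.1 huv hex.choose_spec.2 h
  rcases hT.dist_eq_dist_add_one_of_adj r huv with h | h
  · exact .inl ⟨key u v huv h, h⟩
  · exact .inr ⟨key v u huv.symm h, h⟩

/-- The Helly property of subtrees: finitely many pairwise intersecting connected sets of nodes
of a tree have a common node. -/
theorem IsTree.exists_mem_of_pairwise_inter {T : SimpleGraph V} (hT : T.IsTree) {ι : Type}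
    [Finite ι] [Nonempty ι] (S : ι → Set V) (hS : ∀ i, (T.induce (S i)).Preconnected)
    (hI : ∀ i j, (S i ∩ S j).Nonempty) : ∃ t, ∀ i, t ∈ S i := by
  obtain ⟨p, d, hpd⟩ := hT.exists_parent
  have htop : ∀ i, ∃ t ∈ S i, ∀ w ∈ S i, d t ≤ d w := fun i => by
    have hne : (S i).Nonempty := (hI i i).mono Set.inter_subset_left
    exact ⟨Function.argminOn d (S i) hne, Function.argminOn_mem d (S i) hne,
      fun w hw => Function.argminOn_le d (S i) hw⟩
  choose t htS htmin using htop
  -- Climbing from any node of `S i` reaches the top node `t i` without leaving `S i`.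
  have hanc : ∀ i, ∀ w ∈ S i, ∃ n, p^[n] w = t i ∧ d w = d (t i) + n ∧
      ∀ j ≤ n, p^[j] w ∈ S i := by
    intro i w hw
    have hr := (reachable_iff_reflTransGen _ _).1 (hS i ⟨t i, htS i⟩ ⟨w, hw⟩)
    suffices H : ∀ w : S i, Relation.ReflTransGen (T.induce (S i)).Adj ⟨t i, htS i⟩ w →
        ∃ n, p^[n] w = t i ∧ d w = d (t i) + n ∧ ∀ j ≤ n, p^[j] (w : V) ∈ S i from H ⟨w, hw⟩ hr
    intro w hr
    induction hr with
    | refl => exact ⟨0, rfl, rfl, fun j hj => by simpa [Nat.le_zero.1 hj] using htS i⟩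
    | @tail b c _ hbc ih =>
      obtain ⟨n, h1, h2, h3⟩ := ih
      rcases hpd _ _ (show T.Adj b c from hbc) with ⟨hp, hd⟩ | ⟨hp, hd⟩
      · cases n with
        | zero =>
          have := htmin i c c.2
          omega
        | succ n =>
          refine ⟨n, ?_, by omega, fun j hj => ?_⟩
          · rw [← h1, Function.iterate_succ_apply, hp]
          · have := h3 (j + 1) (by omega)
            rwa [Function.iterate_succ_apply, hp] at this
      · refine ⟨n + 1, by rw [Function.iterate_succ_apply, hp, h1], by omega, fun j hj => ?_⟩
        cases j with
        | zero => exact c.2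
        | succ j =>
          rw [Function.iterate_succ_apply, hp]
          exact h3 j (by omega)
  -- The deepest top node is the common one: climbing from a point of `S i ∩ S i₀`, it is met no
  -- later than `t i`, hence inside `S i`.
  obtain ⟨i₀, hi₀⟩ := Finite.exists_max fun i => d (t i)
  refine ⟨t i₀, fun i => ?_⟩
  obtain ⟨z, hz, hz₀⟩ := hI i i₀
  obtain ⟨n, -, h2, h3⟩ := hanc i z hz
  obtain ⟨m, h1', h2', -⟩ := hanc i₀ z hz₀
  have := hi₀ i
  rw [← h1']
  exact h3 m (by omega)

/-- A union of a chain of connected sets, consecutive ones intersecting, is connected. -/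
theorem preconnected_induce_biUnion_Ico {T : SimpleGraph V} (S : ℕ → Set V)
    (hS : ∀ i, (T.induce (S i)).Preconnected) (a : ℕ) :
    ∀ b, (∀ i, a ≤ i → i + 1 < b → (S i ∩ S (i + 1)).Nonempty) →
      (T.induce {t | ∃ i, a ≤ i ∧ i < b ∧ t ∈ S i}).Preconnected := by
  intro b
  induction b with
  | zero => exact fun _ x => by obtain ⟨_, _, _, h, _⟩ := x; omega
  | succ b ih =>
    intro h
    have ih := ih fun i hi hib => h i hi (by omega)
    rcases lt_trichotomy b a with hb | rfl | hb
    · exact fun x => by obtain ⟨_, _, _, h, _⟩ := x; omega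
    · have : {t | ∃ i, b ≤ i ∧ i < b + 1 ∧ t ∈ S i} = S b := by
        ext t
        refine ⟨?_, fun ht => ⟨b, le_rfl, by omega, ht⟩⟩
        rintro ⟨i, h1, h2, h3⟩
        rwa [show b = i by omega]
      rw [this]
      exact hS b
    · have : {t | ∃ i, a ≤ i ∧ i < b + 1 ∧ t ∈ S i} =
          {t | ∃ i, a ≤ i ∧ i < b ∧ t ∈ S i} ∪ S b := by
        ext t
        constructor
        · rintro ⟨i, h1, h2, h3⟩
          rcases Nat.lt_succ_iff_lt_or_eq.1 h2 with h | rfl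
          · exact .inl ⟨i, h1, h, h3⟩
          · exact .inr h3
        · rintro (⟨i, h1, h2, h3⟩ | h3)
          · exact ⟨i, h1, by omega, h3⟩
          · exact ⟨b, by omega, by omega, h3⟩
      rw [this]
      obtain ⟨z, hz, hz'⟩ := h (b - 1) (by omega) (by omega)
      rw [show b - 1 + 1 = b by omega] at hz'
      exact (induce_union_connected ih (hS b)
        ⟨z, ⟨b - 1, by omega, by omega, hz⟩, hz'⟩).preconnected

/-! ### Building trees for decompositions: paths, and two trees joined by an edge -/

/-- A property that is preserved along edges is preserved by reachability. -/
theorem Reachable.of_adj_imp {G : SimpleGraph V} {P : V → Prop}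
    (hP : ∀ u v, G.Adj u v → P u → P v) {u v : V} (h : G.Reachable u v) (hu : P u) : P v := by
  rw [reachable_iff_reflTransGen] at h
  induction h with
  | refl => exact hu
  | tail _ hbc ih => exact hP _ _ hbc ih

theorem Reachable.map_induce {G : SimpleGraph V} {H : SimpleGraph W} {s : Set V} {t : Set W}
    {u v : s} (h : (G.induce s).Reachable u v) (f : V → W)
    (hf : ∀ x y, G.Adj x y → H.Adj (f x) (f y)) (hst : ∀ x ∈ s, f x ∈ t) :
    (H.induce t).Reachable ⟨f u, hst u u.2⟩ ⟨f v, hst v v.2⟩ :=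
  h.map (⟨fun x => ⟨f x, hst x x.2⟩, fun h => hf _ _ h⟩ : G.induce s →g H.induce t)

theorem isTree_pathGraph_succ (n : ℕ) : (pathGraph (n + 1)).IsTree := by
  refine ⟨pathGraph_connected n, isAcyclic_iff_forall_adj_isBridge.2 ?_⟩
  have key : ∀ u v : Fin (n + 1), u.val + 1 = v.val → (pathGraph (n + 1)).IsBridge s(u, v) := by
    intro u v huv
    rw [isBridge_iff]
    intro h
    -- Only the deleted edge leaves the initial segment ending at `u`.
    have := h.of_adj_imp (P := fun w => w.val ≤ u.val) (fun x y hxy hx => by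
      rw [deleteEdges_adj, pathGraph_adj] at hxy
      obtain ⟨hxy, hne⟩ := hxy
      by_contra hy
      refine hne ?_
      have hxu : x = u := Fin.ext (by omega)
      have hyv : y = v := Fin.ext (by omega)
      simp [hxu, hyv]) le_rfl
    omega
  intro u v huv
  rcases pathGraph_adj.1 huv with h | h
  · exact key u v h
  · rw [Sym2.eq_swap]
    exact key v u h

/-- An interval of the path graph is connected. -/
theorem preconnected_induce_pathGraph {n : ℕ} {s : Set (Fin n)} (hs : s.OrdConnected) :
    ((pathGraph n).induce s).Preconnected := by
  have key : ∀ (m : ℕ) (u v : s), u.1.val + m = v.1.val →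
      ((pathGraph n).induce s).Reachable u v := by
    intro m
    induction m with
    | zero =>
      intro u v h
      rw [show u = v from Subtype.ext (Fin.ext h)]
    | succ m ih =>
      intro u v h
      have hv := v.1.isLt
      have hw : (⟨u.1.val + m, by omega⟩ : Fin n) ∈ s :=
        hs.out u.2 v.2 ⟨Fin.le_def.2 (by simp), Fin.le_def.2 (by simp; omega)⟩
      refine (ih u ⟨_, hw⟩ rfl).trans (Adj.reachable ?_)
      change (pathGraph n).Adj _ _
      rw [pathGraph_adj]
      simp
      omega
  intro u v
  rcases le_total u.1.val v.1.val with h | h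
  · exact key (v.1.val - u.1.val) u v (by omega)
  · exact (key (u.1.val - v.1.val) v u (by omega)).symm

theorem IsAcyclic.sum {G : SimpleGraph V} {H : SimpleGraph W} (hG : G.IsAcyclic)
    (hH : H.IsAcyclic) : (G.sum H).IsAcyclic := by
  rw [isAcyclic_iff_forall_adj_isBridge] at hG hH ⊢
  rintro (u | u) (v | v) huv
  · have hb := isBridge_iff.1 (hG (sum_adj_inl.1 huv))
    refine isBridge_iff.2 fun h => hb ?_
    refine h.of_adj_imp (P := Sum.elim (fun w => (G.deleteEdges {s(u, v)}).Reachable u w)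
      fun _ => False) ?_ (Reachable.refl u)
    rintro (x | x) (y | y) hxy hx
    · refine Reachable.trans hx (Adj.reachable ?_)
      simpa [deleteEdges_adj] using hxy
    · simp [deleteEdges_adj] at hxy
    · exact hx.elim
    · exact hx.elim
  · simp at huv
  · simp at huv
  · have hb := isBridge_iff.1 (hH (sum_adj_inr.1 huv))
    refine isBridge_iff.2 fun h => hb ?_
    refine h.of_adj_imp (P := Sum.elim (fun _ => False)
      fun w => (H.deleteEdges {s(u, v)}).Reachable u w) ?_ (Reachable.refl u)
    rintro (x | x) (y | y) hxy hx
    · exact hx.elim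
    · exact hx.elim
    · simp [deleteEdges_adj] at hxy
    · refine Reachable.trans hx (Adj.reachable ?_)
      simpa [deleteEdges_adj] using hxy

/-- Two trees joined by an edge form a tree. -/
theorem IsTree.sum_sup_edge {G : SimpleGraph V} {H : SimpleGraph W} (hG : G.IsTree)
    (hH : H.IsTree) (v : V) (w : W) : (G.sum H ⊔ edge (.inl v) (.inr w)).IsTree :=
  ⟨hG.connected.sum_sup_edge hH.connected,
    (hG.isAcyclic.sum hH.isAcyclic).sup_edge_of_not_reachable (not_reachable_sum_inl_inr v w)⟩

end SimpleGraph

/-! ## Widths of conjunctive queries -/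

namespace CQ

variable {σ : Schema}

theorem TreeDecomposition.nodeWidth_le_iff {n : ℕ} {q : CQ σ n} (T : q.TreeDecomposition)
    (t : T.Node) (k : ℕ) : T.nodeWidth t ≤ k ↔ ∃ I : Finset (Atom σ q.V),
      (I : Set (Atom σ q.V)) ⊆ q.atoms ∧ T.bag t ⊆ ⋃ a ∈ I, a.vars ∧ I.card ≤ k := by
  constructor
  · intro h
    by_contra! hI
    have : ((k + 1 : ℕ) : ℕ∞) ≤ T.nodeWidth t :=
      le_iInf fun I => le_iInf fun h₁ => le_iInf fun h₂ => by exact_mod_cast hI I h₁ h₂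
    have := this.trans h
    norm_cast at this
    omega
  · rintro ⟨I, h₁, h₂, h₃⟩
    exact (iInf_le_of_le I (iInf_le_of_le h₁ (iInf_le_of_le h₂ le_rfl))).trans
      (by exact_mod_cast h₃)

/-- Widths take discrete values, so if every decomposition had a bag of width at least k+1, the
infimum would be at least k+1 too. -/
theorem mem_GHW_iff {n : ℕ} {q : CQ σ n} {k : ℕ} : q ∈ GHW k ↔
    ∃ T : q.TreeDecomposition, ∀ t, ∃ I : Finset (Atom σ q.V),
      (I : Set (Atom σ q.V)) ⊆ q.atoms ∧ T.bag t ⊆ ⋃ a ∈ I, a.vars ∧ I.card ≤ k := by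
  constructor
  · intro h
    by_contra! hT
    have : ((k + 1 : ℕ) : ℕ∞) ≤ q.ghw := le_iInf fun T => by
      obtain ⟨t, ht⟩ := hT T
      refine le_trans ?_ (le_iSup _ t)
      have : ¬ T.nodeWidth t ≤ k := fun h => by
        obtain ⟨I, h₁, h₂, h₃⟩ := (T.nodeWidth_le_iff t k).1 h
        exact absurd (ht I h₁ h₂) (by omega)
      rw [Nat.cast_add, Nat.cast_one]
      exact Order.add_one_le_of_lt (not_le.1 this)
    have := this.trans (show q.ghw ≤ k from h)
    norm_cast at this
    omega
  · rintro ⟨T, hT⟩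
    change q.ghw ≤ k
    exact iInf_le_of_le T (iSup_le fun t => (T.nodeWidth_le_iff t k).2 (hT t))

@[simp]
theorem mem_exVars (q : CQ σ 0) (y : q.V) : y ∈ q.exVars := by
  rintro ⟨i, -⟩
  exact i.elim0

/-! ## Conjunction of Boolean queries -/

theorem _root_.Atom.vars_map {α β : Type} (f : α → β) (a : Atom σ α) :
    (a.map f).vars = f '' a.vars := Set.range_comp f a.args

theorem mem_eval {q : CQ σ 0} {D : Database σ} {t : Fin 0 → D.Dom} :
    t ∈ q.eval D ↔ ∃ h : q.V → D.Dom, ∀ a ∈ q.atoms, a.map h ∈ D.facts :=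
  exists_congr fun _ => and_iff_left (Subsingleton.elim _ _)

/-- The conjunction of two Boolean queries, over disjoint sets of variables. -/
def conj (q₁ q₂ : CQ σ 0) : CQ σ 0 where
  V := q₁.V ⊕ q₂.V
  atoms := Atom.map Sum.inl '' q₁.atoms ∪ Atom.map Sum.inr '' q₂.atoms
  atoms_finite := (q₁.atoms_finite.image _).union (q₂.atoms_finite.image _)
  free := Fin.elim0
  free_mem := fun i => i.elim0

theorem eval_conj (q₁ q₂ : CQ σ 0) (D : Database σ) :
    (q₁.conj q₂).eval D = q₁.eval D ∩ q₂.eval D := by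
  ext t
  rw [Set.mem_inter_iff, mem_eval, mem_eval, mem_eval]
  constructor
  · rintro ⟨h, hh⟩
    exact ⟨⟨h ∘ Sum.inl, fun a ha => hh _ (.inl ⟨a, ha, rfl⟩)⟩,
      ⟨h ∘ Sum.inr, fun a ha => hh _ (.inr ⟨a, ha, rfl⟩)⟩⟩
  · rintro ⟨⟨h₁, hh₁⟩, ⟨h₂, hh₂⟩⟩
    refine ⟨Sum.elim h₁ h₂, ?_⟩
    rintro _ (⟨a, ha, rfl⟩ | ⟨a, ha, rfl⟩)
    · exact hh₁ a ha
    · exact hh₂ a ha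

/-- Tree decompositions of two Boolean queries, joined by an edge, form a tree decomposition of
their conjunction. -/
def TreeDecomposition.conj {q₁ q₂ : CQ σ 0} (T₁ : q₁.TreeDecomposition)
    (T₂ : q₂.TreeDecomposition) (t₁ : T₁.Node) (t₂ : T₂.Node) :
    (q₁.conj q₂).TreeDecomposition where
  Node := T₁.Node ⊕ T₂.Node
  node_finite := have := T₁.node_finite; have := T₂.node_finite; inferInstance
  tree := T₁.tree.sum T₂.tree ⊔ SimpleGraph.edge (.inl t₁) (.inr t₂)
  isTree := T₁.isTree.sum_sup_edge T₂.isTree t₁ t₂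
  bag := Sum.elim (fun t => Sum.inl '' T₁.bag t) fun t => Sum.inr '' T₂.bag t
  bag_subset := fun _ _ _ => mem_exVars (q₁.conj q₂) _
  atom_subset := by
    rintro _ (⟨a, ha, rfl⟩ | ⟨a, ha, rfl⟩)
    · obtain ⟨t, ht⟩ := T₁.atom_subset a ha
      refine ⟨.inl t, fun y hy => ?_⟩
      obtain ⟨x, hx, rfl⟩ := (Atom.vars_map Sum.inl a).subset hy.1
      exact ⟨x, ht ⟨hx, mem_exVars q₁ x⟩, rfl⟩
    · obtain ⟨t, ht⟩ := T₂.atom_subset a ha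
      refine ⟨.inr t, fun y hy => ?_⟩
      obtain ⟨x, hx, rfl⟩ := (Atom.vars_map Sum.inr a).subset hy.1
      exact ⟨x, ht ⟨hx, mem_exVars q₂ x⟩, rfl⟩
  preconnected := by
    rintro (y | y) -
    · rintro ⟨u | u, x, hx, hxy⟩ ⟨v | v, x', hx', hxy'⟩
      · cases hxy
        cases hxy'
        exact SimpleGraph.Reachable.map_induce
          (T₁.preconnected y (mem_exVars q₁ y) ⟨u, hx⟩ ⟨v, hx'⟩) Sum.inl
          (fun _ _ h => Or.inl (by exact h)) (fun w hw => (⟨y, hw, rfl⟩ : ∃ x, x ∈ T₁.bag w ∧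
            Sum.inl x = Sum.inl y))
      · cases hxy'
      · cases hxy
      · cases hxy
    · rintro ⟨u | u, x, hx, hxy⟩ ⟨v | v, x', hx', hxy'⟩
      · cases hxy
      · cases hxy
      · cases hxy'
      · cases hxy
        cases hxy'
        exact SimpleGraph.Reachable.map_induce
          (T₂.preconnected y (mem_exVars q₂ y) ⟨u, hx⟩ ⟨v, hx'⟩) Sum.inr
          (fun _ _ h => Or.inl (by exact h)) (fun w hw => (⟨y, hw, rfl⟩ : ∃ x, x ∈ T₂.bag w ∧
            Sum.inr x = Sum.inr y))

theorem exists_cover_map {q q' : CQ σ 0} (f : q.V → q'.V)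
    (hf : ∀ a ∈ q.atoms, a.map f ∈ q'.atoms) {s : Set q.V} {k : ℕ}
    (h : ∃ I : Finset (Atom σ q.V),
      (I : Set (Atom σ q.V)) ⊆ q.atoms ∧ s ⊆ ⋃ a ∈ I, a.vars ∧ I.card ≤ k) :
    ∃ I : Finset (Atom σ q'.V),
      (I : Set (Atom σ q'.V)) ⊆ q'.atoms ∧ f '' s ⊆ ⋃ a ∈ I, a.vars ∧ I.card ≤ k := by
  classical
  obtain ⟨I, h₁, h₂, h₃⟩ := h
  refine ⟨I.image (Atom.map f), ?_, ?_, Finset.card_image_le.trans h₃⟩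
  · rw [Finset.coe_image]
    rintro _ ⟨a, ha, rfl⟩
    exact hf a (h₁ ha)
  · rintro _ ⟨x, hx, rfl⟩
    obtain ⟨a, ha, hxa⟩ := Set.mem_iUnion₂.1 (h₂ hx)
    refine Set.mem_iUnion₂.2 ⟨a.map f, Finset.mem_image_of_mem _ ha, ?_⟩
    rw [Atom.vars_map]
    exact ⟨x, hxa, rfl⟩

theorem conj_mem_GHW {q₁ q₂ : CQ σ 0} {k : ℕ} (h₁ : q₁ ∈ GHW k) (h₂ : q₂ ∈ GHW k) :
    q₁.conj q₂ ∈ GHW k := by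
  rw [mem_GHW_iff] at *
  obtain ⟨T₁, h₁⟩ := h₁
  obtain ⟨T₂, h₂⟩ := h₂
  obtain ⟨t₁⟩ := T₁.isTree.connected.nonempty
  obtain ⟨t₂⟩ := T₂.isTree.connected.nonempty
  refine ⟨T₁.conj T₂ t₁ t₂, ?_⟩
  rintro (t | t)
  · exact exists_cover_map (q := q₁) (q' := q₁.conj q₂) Sum.inl (fun a ha => .inl ⟨a, ha, rfl⟩)
      (h₁ t)
  · exact exists_cover_map (q := q₂) (q' := q₁.conj q₂) Sum.inr (fun a ha => .inr ⟨a, ha, rfl⟩)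
      (h₂ t)

/-- An overapproximation of a Boolean query `q` is contained in every query of the class that
contains `q`. -/
theorem IsOverapproximation.contained {k : ℕ} {q q' p : CQ σ 0} (h : IsOverapproximation k q q')
    (hp : p ∈ GHW k) (hqp : q.Contained p) : q'.Contained p := by
  obtain ⟨hq', hqq', hmax⟩ := h
  have hc : q.Contained (q'.conj p) := fun D => by
    rw [eval_conj]
    exact Set.subset_inter (hqq' D) (hqp D)
  -- The conjunction errs only on tuples outside q that q' already returns.
  have hle : ApproxLE q q' (q'.conj p) := by
    intro D x hx
    have := hc D
    rcases hx with ⟨h₁, h₂⟩ | ⟨h₁, h₂⟩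
    · exact absurd (this h₁) h₂
    · rw [eval_conj] at h₁
      exact .inr ⟨h₁.1, h₂⟩
  have hge : ApproxLE q (q'.conj p) q' := by
    by_contra hn
    exact hmax ⟨_, conj_mem_GHW hq' hp, hc, hle, hn⟩
  intro D x hx
  by_cases hxq : x ∈ q.eval D
  · exact hqp D hxq
  · rcases hge D (.inr ⟨hx, hxq⟩) with ⟨h₁, -⟩ | ⟨h₁, -⟩
    · exact absurd h₁ hxq
    · rw [eval_conj] at h₁
      exact h₁.2

/-- The canonical database of a query, with one additional constant. -/
def canonicalDatabase (q : CQ σ 0) : Database σ where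
  Dom := Option q.V
  dom_nonempty := ⟨none⟩
  facts := Atom.map some '' q.atoms
  facts_finite := q.atoms_finite.image _

/-- Evaluate both queries on the canonical database of `q`. Its extra constant only keeps the domain
nonempty, hence the `Option`. -/
theorem Contained.exists_hom {q p : CQ σ 0} (h : q.Contained p) :
    ∃ f : p.V → Option q.V, ∀ a ∈ p.atoms, a.map f ∈ Atom.map some '' q.atoms := by
  have : (Fin.elim0 : Fin 0 → Option q.V) ∈ q.eval q.canonicalDatabase :=
    mem_eval.2 ⟨some, fun a ha => ⟨a, ha, rfl⟩⟩
  exact mem_eval.1 (h _ this)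

theorem contained_of_hom {q p : CQ σ 0} (f : p.V → q.V)
    (hf : ∀ a ∈ p.atoms, a.map f ∈ q.atoms) : q.Contained p := by
  intro D t ht
  obtain ⟨h, hh⟩ := mem_eval.1 ht
  exact mem_eval.2 ⟨h ∘ f, fun a ha => hh _ (hf a ha)⟩

end CQ

/-! ## Queries over the schema of directed graphs -/

@[simp]
theorem edgeAtom_inj {V : Type} {u v u' v' : V} :
    edgeAtom u v = edgeAtom u' v' ↔ u = u' ∧ v = v' := by
  refine ⟨fun h => ?_, fun h => by rw [h.1, h.2]⟩
  have h : (![u, v] : Fin 2 → V) = ![u', v'] := eq_of_heq (Atom.mk.inj h).2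
  exact ⟨congrFun h 0, congrFun h 1⟩

theorem edgeAtom_map {V W : Type} (f : V → W) (u v : V) :
    (edgeAtom u v).map f = edgeAtom (f u) (f v) := by
  refine congrArg (Atom.mk (σ := graphSchema) ()) ?_
  funext i
  change Fin 2 at i
  fin_cases i <;> rfl

theorem vars_edgeAtom {V : Type} (u v : V) : (edgeAtom u v).vars = {u, v} :=
  Matrix.range_cons_cons_empty u v ![]

theorem eq_edgeAtom {V : Type} (a : Atom graphSchema V) : ∃ u v, a = edgeAtom u v := by
  obtain ⟨⟨⟩, f⟩ := a
  change Fin 2 → V at f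
  refine ⟨f 0, f 1, congrArg (Atom.mk (σ := graphSchema) ()) ?_⟩
  funext i
  change Fin 2 at i
  fin_cases i <;> rfl

/-- The list f 0, …, f (2k-1) is cut into k consecutive pairs, each an edge; repetitions are
harmless. -/
theorem exists_cover_of_edges {V : Type} {A : Set (Atom graphSchema V)} {s : Set V} (k : ℕ)
    (f : ℕ → V) (hA : ∀ t < k, edgeAtom (f (2 * t)) (f (2 * t + 1)) ∈ A)
    (hs : ∀ x ∈ s, ∃ i < 2 * k, f i = x) : ∃ I : Finset (Atom graphSchema V),
      (I : Set (Atom graphSchema V)) ⊆ A ∧ s ⊆ ⋃ a ∈ I, a.vars ∧ I.card ≤ k := by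
  classical
  refine ⟨(Finset.range k).image fun t => edgeAtom (f (2 * t)) (f (2 * t + 1)), ?_, ?_,
    Finset.card_image_le.trans (Finset.card_range k).le⟩
  · rw [Finset.coe_image]
    rintro _ ⟨t, ht, rfl⟩
    exact hA t (by simpa using ht)
  · intro x hx
    obtain ⟨i, hi, rfl⟩ := hs x hx
    refine Set.mem_iUnion₂.2 ⟨_, Finset.mem_image_of_mem _
      (Finset.mem_range.2 (show i / 2 < k by omega)), ?_⟩
    rw [vars_edgeAtom]
    rcases Nat.mod_two_eq_zero_or_one i with h | h
    · exact .inl (congrArg f (by omega))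
    · exact .inr (congrArg f (by omega))

/-- At most `2 * k` variables are covered by `k` atoms of arity two. -/
theorem card_le_of_cover {V : Type} (s : Finset V) {k : ℕ} {I : Finset (Atom graphSchema V)}
    (hs : (s : Set V) ⊆ ⋃ a ∈ I, a.vars) (hI : I.card ≤ k) : s.card ≤ 2 * k := by
  classical
  have hsub : s ⊆ I.biUnion fun a => {a.args (0 : Fin 2), a.args (1 : Fin 2)} := by
    intro x hx
    obtain ⟨a, ha, hxa⟩ := Set.mem_iUnion₂.1 (hs hx)
    refine Finset.mem_biUnion.2 ⟨a, ha, ?_⟩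
    obtain ⟨u, v, rfl⟩ := eq_edgeAtom a
    rw [vars_edgeAtom] at hxa
    rcases hxa with rfl | rfl
    · exact Finset.mem_insert_self _ _
    · exact Finset.mem_insert_of_mem (Finset.mem_singleton_self _)
  calc s.card ≤ _ := Finset.card_le_card hsub
    _ ≤ I.card * 2 := Finset.card_biUnion_le_card_mul _ _ _ fun a _ => Finset.card_le_two
    _ ≤ 2 * k := by omega

/-! ## Band queries -/

/-- The band tournament of width `w` on the natural numbers: `u` and `v` are joined if they differ
by less than `w`; the edge goes to the larger one if their difference is odd, and to the smaller
one otherwise. -/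
def BandAdj (w u v : ℕ) : Prop :=
  (u < v ∧ v < u + w ∧ (u + v) % 2 = 1) ∨ (v < u ∧ u < v + w ∧ (u + v) % 2 = 0)

/-- The Boolean query whose canonical database is the band tournament of width `w` on the numbers
below `N`. -/
def bandCQ (w N : ℕ) : CQ graphSchema 0 where
  V := ℕ
  atoms := {a | ∃ u v, u < N ∧ v < N ∧ BandAdj w u v ∧ a = edgeAtom u v}
  atoms_finite := (((Set.finite_Iio N).prod (Set.finite_Iio N)).image
    fun p => edgeAtom p.1 p.2).subset (by
      rintro _ ⟨u, v, hu, hv, -, rfl⟩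
      exact ⟨(u, v), ⟨hu, hv⟩, rfl⟩)
  free := Fin.elim0
  free_mem := fun i => i.elim0

/-- The path decomposition of a band query whose bags are the intervals of length `w`. -/
def bandDecomposition (w n : ℕ) : (bandCQ w (n + w)).TreeDecomposition where
  Node := Fin (n + 1)
  node_finite := inferInstance
  tree := SimpleGraph.pathGraph (n + 1)
  isTree := SimpleGraph.isTree_pathGraph_succ n
  bag := fun t => {x : ℕ | t.val ≤ x ∧ x < t.val + w}
  bag_subset := fun _ _ _ => CQ.mem_exVars (bandCQ w (n + w)) _
  atom_subset := by
    rintro _ ⟨u, v, hu, hv, huv, rfl⟩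
    -- The window starts at the smaller endpoint, capped at the last window.
    refine ⟨⟨min n (min u v), by omega⟩, fun x hx => ?_⟩
    unfold BandAdj at huv
    change ℕ at x
    change min n (min u v) ≤ x ∧ x < min n (min u v) + w
    have : x = u ∨ x = v := (vars_edgeAtom u v).subset hx.1
    omega
  preconnected := fun y _ => SimpleGraph.preconnected_induce_pathGraph ⟨by
    rintro a ⟨ha, ha'⟩ b ⟨hb, hb'⟩ c ⟨hac, hcb⟩
    rw [Fin.le_def] at hac hcb
    change ℕ at y
    exact ⟨hcb.trans hb, by omega⟩⟩

theorem bandCQ_mem_GHW (ℓ n : ℕ) : bandCQ (2 * ℓ) (n + 2 * ℓ) ∈ CQ.GHW ℓ := by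
  refine CQ.mem_GHW_iff.2 ⟨bandDecomposition (2 * ℓ) n, fun t => ?_⟩
  change Fin (n + 1) at t
  refine exists_cover_of_edges (V := ℕ) ℓ (fun i => t.val + i) (fun s hs => ?_) ?_
  · have := t.isLt
    exact ⟨_, _, by omega, by omega, .inl (by omega), rfl⟩
  · rintro x ⟨hx, hx'⟩
    change ℕ at x
    exact ⟨x - t.val, by omega, by omega⟩

/-- A homomorphism from a band query of width `2 * ℓ` to a query of generalized hypertreewidth at
most `ℓ` without loops and directed cycles of length two is injective. -/
theorem band_hom_ne {q : CQ graphSchema 0} {ℓ N : ℕ} (hℓ : 1 ≤ ℓ) (hq : q ∈ CQ.GHW ℓ)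
    (hanti : ∀ x z, edgeAtom x z ∈ q.atoms → edgeAtom z x ∉ q.atoms) (y : ℕ → q.V)
    (hy : ∀ u v, u < N → v < N → BandAdj (2 * ℓ) u v → edgeAtom (y u) (y v) ∈ q.atoms) :
    ∀ d, 0 < d → ∀ a, a + d < N → y a ≠ y (a + d) := by
  classical
  obtain ⟨T, hT⟩ := CQ.mem_GHW_iff.1 hq
  have hedge : ∀ u v, u < N → v < N → u < v → v < u + 2 * ℓ →
      edgeAtom (y u) (y v) ∈ q.atoms ∨ edgeAtom (y v) (y u) ∈ q.atoms := by
    intro u v hu hv huv hvu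
    rcases Nat.mod_two_eq_zero_or_one (u + v) with h | h
    · exact .inr (hy _ _ hv hu (.inr ⟨huv, hvu, by omega⟩))
    · exact .inl (hy _ _ hu hv (.inl ⟨huv, hvu, h⟩))
  let S : ℕ → Set T.Node := fun u => {t | y u ∈ T.bag t}
  have hmeet : ∀ u v, u < N → v < N → u < v → v < u + 2 * ℓ → (S u ∩ S v).Nonempty := by
    intro u v hu hv huv hvu
    rcases hedge u v hu hv huv hvu with h | h
    · obtain ⟨t, ht⟩ := T.atom_subset _ h
      rw [vars_edgeAtom] at ht
      exact ⟨t, ht ⟨.inl rfl, q.mem_exVars _⟩, ht ⟨.inr rfl, q.mem_exVars _⟩⟩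
    · obtain ⟨t, ht⟩ := T.atom_subset _ h
      rw [vars_edgeAtom] at ht
      exact ⟨t, ht ⟨.inr rfl, q.mem_exVars _⟩, ht ⟨.inl rfl, q.mem_exVars _⟩⟩
  intro d
  induction d using Nat.strong_induction_on with
  | _ d ih =>
  intro hd a haN heq
  have hne : ∀ i j, a ≤ i → i < j → j < a + d → y i ≠ y j := by
    intro i j hi hij hj
    have := ih (j - i) (by omega) (by omega) i (by omega)
    rwa [show i + (j - i) = j by omega] at this
  rcases lt_trichotomy d (2 * ℓ) with hlt | rfl | hgt
  -- The colliding vertices are adjacent: a loop.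
  · have := hedge a (a + d) (by omega) haN (by omega) (by omega)
    rw [← heq, or_self] at this
    exact hanti _ _ this this
  -- Both 1 and 2ℓ-1 are odd, so a → a+1 → a+2ℓ collapses to a directed 2-cycle.
  · have h₁ := hy a (a + 1) (by omega) (by omega) (.inl (by omega))
    have h₂ := hy (a + 1) (a + 2 * ℓ) (by omega) haN (.inl (by omega))
    rw [← heq] at h₂
    exact hanti _ _ h₁ h₂
  -- The rest of the closed-up band is contracted to one subtree `U`. It meets `S a` through a+d-1,
  -- a neighbour of a+d, and the other window subtrees through a+2ℓ.
  · let U : Set T.Node := {t | ∃ i, a + 2 * ℓ ≤ i ∧ i < a + d ∧ t ∈ S i}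
    have hconn : ∀ u, (T.tree.induce (S u)).Preconnected :=
      fun u => T.preconnected (y u) (q.mem_exVars _)
    have hU : (T.tree.induce U).Preconnected :=
      SimpleGraph.preconnected_induce_biUnion_Ico S hconn _ _ fun i h₁ h₂ =>
        hmeet i (i + 1) (by omega) (by omega) (by omega) (by omega)
    have hSU : ∀ i < 2 * ℓ, (S (a + i) ∩ U).Nonempty := by
      intro i hi
      rcases Nat.eq_zero_or_pos i with rfl | hi0
      · obtain ⟨t, ht, ht'⟩ := hmeet (a + d - 1) (a + d) (by omega) haN (by omega) (by omega)
        refine ⟨t, ?_, a + d - 1, by omega, by omega, ht⟩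
        change y (a + 0) ∈ T.bag t
        rw [Nat.add_zero, heq]
        exact ht'
      · obtain ⟨t, ht, ht'⟩ :=
          hmeet (a + i) (a + 2 * ℓ) (by omega) (by omega) (by omega) (by omega)
        exact ⟨t, ht, a + 2 * ℓ, le_rfl, by omega, ht'⟩
    obtain ⟨t, ht⟩ := T.isTree.exists_mem_of_pairwise_inter
      (fun o : Option (Fin (2 * ℓ)) => o.elim U fun i => S (a + i)) (by
        rintro (_ | i)
        · exact hU
        · exact hconn _) (by
        rintro (_ | i) (_ | j)
        · obtain ⟨t, -, ht⟩ := hSU 0 (by omega)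
          exact ⟨t, ht, ht⟩
        · exact (Set.inter_comm _ _).subst (hSU j j.2)
        · exact hSU i i.2
        · have := i.2
          have := j.2
          rcases lt_trichotomy i.val j.val with h | h | h
          · exact hmeet _ _ (by omega) (by omega) (by omega) (by omega)
          · obtain ⟨t, ht, -⟩ := hSU i i.2
            exact ⟨t, ht, by simpa [h] using ht⟩
          · exact (Set.inter_comm _ _).subst
              (hmeet (a + j) (a + i) (by omega) (by omega) (by omega) (by omega)))
    obtain ⟨j, hj, hj', htj⟩ := ht none
    obtain ⟨I, -, hI, hcard⟩ := hT t
    have hinj : Set.InjOn y (insert j (Finset.Ico a (a + 2 * ℓ)) : Finset ℕ) := by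
      have hmem : ∀ x ∈ insert j (Finset.Ico a (a + 2 * ℓ)), a ≤ x ∧ x < a + d := by
        intro x hx
        rw [Finset.mem_insert, Finset.mem_Ico] at hx
        omega
      intro u hu v hv huv
      have hu := hmem u hu
      have hv := hmem v hv
      by_contra hn
      rcases Nat.lt_or_gt_of_ne hn with h | h
      · exact hne u v hu.1 h hv.2 huv
      · exact hne v u hv.1 h hu.2 huv.symm
    have hle := card_le_of_cover ((insert j (Finset.Ico a (a + 2 * ℓ))).image y) (k := ℓ)
      (I := I) (by
        refine Set.Subset.trans ?_ hI
        rw [Finset.coe_image]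
        rintro _ ⟨x, hx, rfl⟩
        rw [Finset.mem_coe, Finset.mem_insert, Finset.mem_Ico] at hx
        rcases hx with rfl | ⟨h₁, h₂⟩
        · exact htj
        · have := ht (some ⟨x - a, by omega⟩)
          change y (a + (x - a)) ∈ T.bag t at this
          rwa [show a + (x - a) = x by omega] at this) hcard
    rw [Finset.card_image_of_injOn hinj, Finset.card_insert_of_notMem (by simp; omega),
      Nat.card_Ico] at hle
    omega

/-- A query of generalized hypertreewidth at most `ℓ` without loops and directed cycles of length
two is not contained in all band queries of width `2 * ℓ`. -/
theorem exists_not_contained_bandCQ {q : CQ graphSchema 0} {ℓ : ℕ} (hℓ : 1 ≤ ℓ)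
    (hq : q ∈ CQ.GHW ℓ)
    (hanti : ∀ x z, edgeAtom x z ∈ q.atoms → edgeAtom z x ∉ q.atoms) :
    ∃ n, ¬ q.Contained (bandCQ (2 * ℓ) (n + 2 * ℓ)) := by
  classical
  let F : Set q.V := ⋃ a ∈ q.atoms, a.vars
  have hF : F.Finite := q.atoms_finite.biUnion fun a _ => by
    obtain ⟨u, v, rfl⟩ := eq_edgeAtom a
    rw [vars_edgeAtom]
    exact Set.toFinite _
  -- This makes the band longer than the number of variables occurring in `q`.
  refine ⟨F.ncard, fun hc => ?_⟩
  set N := F.ncard + 2 * ℓ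
  obtain ⟨f, hf⟩ := hc.exists_hom
  change ℕ → Option q.V at f
  have hf' : ∀ u v, u < N → v < N → BandAdj (2 * ℓ) u v →
      ∃ x z, f u = some x ∧ f v = some z ∧ edgeAtom x z ∈ q.atoms := by
    intro u v hu hv huv
    obtain ⟨a, ha, hau⟩ := hf (edgeAtom u v) ⟨u, v, hu, hv, huv, rfl⟩
    obtain ⟨x, z, rfl⟩ := eq_edgeAtom a
    have hau := edgeAtom_inj.1 ((edgeAtom_map some x z).symm.trans (hau.trans (edgeAtom_map f u v)))
    exact ⟨x, z, hau.1.symm, hau.2.symm, ha⟩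
  obtain ⟨x₀, -⟩ := hf' 0 1 (by omega) (by omega) (.inl (by omega))
  let y : ℕ → q.V := fun u => (f u).getD x₀
  have hy : ∀ u v, u < N → v < N → BandAdj (2 * ℓ) u v →
      edgeAtom (y u) (y v) ∈ q.atoms := by
    intro u v hu hv huv
    obtain ⟨x, z, hx, hz, h⟩ := hf' u v hu hv huv
    simpa [y, hx, hz] using h
  have hne := band_hom_ne hℓ hq hanti y hy
  have hinj : Set.InjOn y (Set.Iio N) := by
    intro u hu v hv huv
    by_contra hn
    rcases Nat.lt_or_gt_of_ne hn with h | h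
    · refine hne (v - u) (by omega) u ?_ ?_ <;> rw [show u + (v - u) = v by omega]
      · exact hv
      · exact huv
    · refine hne (u - v) (by omega) v ?_ ?_ <;> rw [show v + (u - v) = u by omega]
      · exact hu
      · exact huv.symm
  have hmaps : y '' Set.Iio N ⊆ F := by
    rintro _ ⟨u, hu, rfl⟩
    rw [Set.mem_Iio] at hu
    rcases Nat.eq_zero_or_pos u with rfl | h
    · refine Set.mem_iUnion₂.2 ⟨_, hy 0 1 hu (by omega) (.inl (by omega)), ?_⟩
      rw [vars_edgeAtom]
      exact .inl rfl
    · refine Set.mem_iUnion₂.2 ⟨_, hy (u - 1) u (by omega) hu (.inl (by omega)), ?_⟩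
      rw [vars_edgeAtom]
      exact .inr rfl
  have hle := Set.ncard_le_ncard hmaps hF
  rw [hinj.ncard_image, ← Finset.coe_Iio, Set.ncard_coe_finset, Nat.card_Iio] at hle
  omega

/-! ## The tournament -/

/-- The tournament on `m` nodes, `m` odd, in which there is an edge from `i` to `j` if `j - i`,
reduced modulo `m`, is odd. -/
def cyclicTournament (m : ℕ) : Digraph (Fin m) where
  Adj i j := (i.val < j.val ∧ (i.val + j.val) % 2 = 1) ∨ (j.val < i.val ∧ (i.val + j.val) % 2 = 0)

theorem cyclicTournament_isTournament (m : ℕ) : IsTournament (cyclicTournament m) := by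
  refine ⟨fun u h => ?_, fun u v huv => ?_⟩
  · change _ ∨ _ at h
    omega
  · have : u.val ≠ v.val := fun h => huv (Fin.ext h)
    change ((_ ∨ _) ∧ ¬ (_ ∨ _)) ∨ ((_ ∨ _) ∧ ¬ (_ ∨ _))
    omega

theorem cyclicTournament_firstThreeCycle {m : ℕ} (hm : 3 ≤ m) :
    FirstThreeCycle (cyclicTournament m) :=
  ⟨hm, .inl (by simp), .inl (by simp), .inr (by simp)⟩

/-- If all nodes outside `B` saw `B` alike, take `a` outside with cyclic successor `b` in `B`,
another `u` outside, and the successor `w` of `u`. Since a → b, also u → b. If `w` is in `B`, then u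
→ w gives a → w; otherwise w → b. Either one contradicts u → b by the parity of cyclic differences.
-/
theorem cyclicTournament_dagger {m : ℕ} (hm : m % 2 = 1) : Dagger (cyclicTournament m) := by
  classical
  intro B hB hBm v hv
  by_contra! hall
  have hconn : ∀ v' ∉ B, ∀ p ∈ B,
      ((cyclicTournament m).Adj v p ↔ (cyclicTournament m).Adj v' p) := by
    intro v' hv' p hp
    have h := congrFun (hall v' hv') p
    simp only [conn, hp, not_true_eq_false, if_false] at h
    by_cases h₁ : (cyclicTournament m).Adj v p <;> by_cases h₂ : (cyclicTournament m).Adj v' p <;>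
      simp_all
  have hmod : ∀ u ∉ B, ∀ u' ∉ B, ∀ p ∈ B,
      (cyclicTournament m).Adj u p → (cyclicTournament m).Adj u' p :=
    fun u hu u' hu' p hp h => (hconn u' hu' p hp).1 ((hconn u hu p hp).2 h)
  have hm0 : 0 < m := by omega
  obtain ⟨a, ha, b, hb, hab⟩ : ∃ a ∉ B, ∃ b ∈ B, b.val = (a.val + 1) % m := by
    by_contra! hn
    have hstep : ∀ n, (⟨(v.val + n) % m, Nat.mod_lt _ hm0⟩ : Fin m) ∉ B := by
      intro n
      induction n with
      | zero => simpa [Nat.mod_eq_of_lt v.isLt] using hv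
      | succ n ih => exact fun h => hn _ ih _ h (by simp [Nat.add_assoc])
    obtain ⟨b, hb⟩ := Finset.card_pos.1 (by omega : 0 < B.card)
    have := hstep (m - v.val + b.val)
    simp only [show v.val + (m - v.val + b.val) = b.val + m by have := v.isLt; omega,
      Nat.add_mod_right, Nat.mod_eq_of_lt b.isLt] at this
    exact this hb
  obtain ⟨u, hu, hua⟩ : ∃ u ∉ B, u ≠ a := by
    have : 1 < Bᶜ.card := by
      rw [Finset.card_compl, Fintype.card_fin]
      omega
    obtain ⟨u, hu, hua⟩ := Finset.exists_mem_ne this a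
    exact ⟨u, Finset.mem_compl.1 hu, hua⟩
  have hsucc : ∀ x : Fin m, (x.val + 1 = m ∧ (x.val + 1) % m = 0) ∨
      (x.val + 1 < m ∧ (x.val + 1) % m = x.val + 1) := by
    intro x
    rcases Nat.lt_or_ge (x.val + 1) m with h | h
    · exact .inr ⟨h, Nat.mod_eq_of_lt h⟩
    · have : x.val + 1 = m := by omega
      exact .inl ⟨this, by rw [this, Nat.mod_self]⟩
  have hne : u.val ≠ a.val := fun h => hua (Fin.ext h)
  obtain ⟨w, hw⟩ : ∃ w : Fin m, w.val = (u.val + 1) % m := ⟨⟨_, Nat.mod_lt _ hm0⟩, rfl⟩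
  have ha' := hsucc a
  have hu' := hsucc u
  rw [← hab] at ha'
  rw [← hw] at hu'
  have hub := hmod a ha u hu b hb (by change _ ∨ _; omega)
  change _ ∨ _ at hub
  by_cases hwB : w ∈ B
  · have h := hmod u hu a ha w hwB (by change _ ∨ _; omega)
    change _ ∨ _ at h
    omega
  · have h := hmod a ha w hwB b hb (by change _ ∨ _; omega)
    change _ ∨ _ at h
    omega

/-- Reduction modulo `m` maps bands of width less than `m` to the tournament. -/
theorem cyclicTournament_adj_mod {m w u v : ℕ} (hm : m % 2 = 1) (hw : w ≤ m)
    (h : BandAdj w u v) : (cyclicTournament m).Adj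
      ⟨u % m, Nat.mod_lt _ (by omega)⟩ ⟨v % m, Nat.mod_lt _ (by omega)⟩ := by
  have hm0 : 0 < m := by omega
  -- Wrapping around subtracts the odd number `m`, so the parity of the sum flips exactly when the
  -- order of the residues does.
  have key : ∀ x y, x < y → y < x + m →
      y % m = x % m + (y - x) ∨ y % m + m = x % m + (y - x) := by
    intro x y hxy hyx
    have h₁ := Nat.mod_lt x hm0
    have h₂ : y % m = (x % m + (y - x)) % m := by
      rw [Nat.mod_add_mod]
      congr 1
      omega
    rw [h₂]
    rcases Nat.lt_or_ge (x % m + (y - x)) m with h | h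
    · exact .inl (Nat.mod_eq_of_lt h)
    · right
      rw [Nat.mod_eq_sub_mod h, Nat.mod_eq_of_lt (by omega)]
      omega
  have hu := Nat.mod_lt u hm0
  have hv := Nat.mod_lt v hm0
  change _ ∨ _
  dsimp only
  rcases h with ⟨h₁, h₂, h₃⟩ | ⟨h₁, h₂, h₃⟩
  · have := key u v h₁ (by omega)
    omega
  · have := key v u h₁ (by omega)
    omega

theorem cyclicTournament_mem_GHW {k : ℕ} (hk : 1 < k) :
    digraphCQ (cyclicTournament (2 * k - 1)) ∈ CQ.GHW k := by
  have hm0 : 0 < 2 * k - 1 := by omega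
  let T : (digraphCQ (cyclicTournament (2 * k - 1))).TreeDecomposition :=
    { Node := Unit
      node_finite := inferInstance
      tree := ⊥
      isTree := SimpleGraph.IsTree.of_subsingleton
      bag := fun _ => Set.univ
      bag_subset := fun _ _ _ => CQ.mem_exVars _ _
      atom_subset := fun _ _ => ⟨(), fun _ _ => trivial⟩
      preconnected := fun _ _ u v => by rw [Subsingleton.elim u v] }
  refine CQ.mem_GHW_iff.2 ⟨T, fun t => ?_⟩
  refine exists_cover_of_edges (V := Fin (2 * k - 1)) k
    (fun i => ⟨i % (2 * k - 1), Nat.mod_lt _ hm0⟩) (fun t _ => ?_) fun x _ => ?_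
  -- The k edges follow the cycle 0 → 1 → ⋯; the last one wraps from 2k-2 to 0.
  · exact ⟨_, _, cyclicTournament_adj_mod (w := 2) (by omega) (by omega) (.inl (by omega)), rfl⟩
  · change Fin (2 * k - 1) at x
    exact ⟨x.val, by have := x.isLt; omega, Fin.ext (Nat.mod_eq_of_lt x.isLt)⟩

/-! ### The main theorem -/

theorem mainTheorem7 (k : ℕ) (hk : 1 < k) :
    ∃ G : Digraph (Fin (2 * k - 1)),
      IsTournament G ∧ FirstThreeCycle G ∧ Dagger G ∧
      digraphCQ G ∈ CQ.GHW k ∧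
      ∀ ℓ : ℕ, 1 ≤ ℓ → ℓ < k →
        ¬ ∃ q' : CQ graphSchema 0, CQ.IsOverapproximation ℓ (digraphCQ G) q' := by
  have htour := cyclicTournament_isTournament (2 * k - 1)
  refine ⟨cyclicTournament (2 * k - 1), htour,
    cyclicTournament_firstThreeCycle (by omega), cyclicTournament_dagger (by omega),
    cyclicTournament_mem_GHW hk, ?_⟩
  rintro ℓ hℓ hℓk ⟨q, hq⟩
  obtain ⟨f, hf⟩ := hq.2.1.exists_hom
  have hf' : ∀ x z, edgeAtom x z ∈ q.atoms → ∃ u v, f x = some u ∧ f z = some v ∧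
      (cyclicTournament (2 * k - 1)).Adj u v := by
    intro x z h
    obtain ⟨_, ⟨u, v, huv, rfl⟩, h⟩ := hf _ h
    obtain ⟨h₁, h₂⟩ :=
      edgeAtom_inj.1 ((edgeAtom_map some u v).symm.trans (h.trans (edgeAtom_map f x z)))
    exact ⟨u, v, h₁.symm, h₂.symm, huv⟩
  -- The tournament has neither loops nor 2-cycles, and this pulls back along `f`.
  have hanti : ∀ x z, edgeAtom x z ∈ q.atoms → edgeAtom z x ∉ q.atoms := by
    intro x z h₁ h₂
    obtain ⟨u, v, hu, hv, huv⟩ := hf' _ _ h₁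
    obtain ⟨v', u', hv', hu', hvu⟩ := hf' _ _ h₂
    obtain rfl : u = u' := Option.some_injective _ (hu.symm.trans hu')
    obtain rfl : v = v' := Option.some_injective _ (hv.symm.trans hv')
    by_cases h : u = v
    · exact htour.1 u (h ▸ huv)
    · rcases htour.2 u v h with ⟨-, h⟩ | ⟨-, h⟩
      · exact h hvu
      · exact h huv
  obtain ⟨n, hn⟩ := exists_not_contained_bandCQ hℓ hq.1 hanti
  refine hn (hq.contained (bandCQ_mem_GHW ℓ n) (CQ.contained_of_hom
    (fun u : ℕ => (⟨u % (2 * k - 1), Nat.mod_lt _ (by omega)⟩ : Fin (2 * k - 1))) ?_))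
  rintro _ ⟨u, v, -, -, huv, rfl⟩
  exact ⟨_, _, cyclicTournament_adj_mod (by omega) (by omega) huv, edgeAtom_map _ u v⟩
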